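/- Let $\Delta$ be the category of simplices $\Delta^m$ ($m\ge 0$), and let $\mathcal A\subset\prod_{n\ge 1}\Delta$ be the full subcategory of the objects $A=(A_1,A_2,\dots)$ with $A_n=\Delta^0$ for all but finitely many $n$. For a morphism $f$ of $\mathcal A$, let $\deg f$ be the smallest $k\ge 1$ such that $f_k$ is constant, i.e. factors through $\Delta^0$. For parallel morphisms, write $f\sim g$ if $\deg f=\deg g=:d$ and $f_1=g_1,\dots,f_d=g_d$; this is a congruence on $\mathcal A$. For $A\in\mathcal A$, let $\dim A$ be the smallest $d\ge 0$ with $A_{d+1}=\Delta^0$. Let $\Theta\subset\mathcal A/{\sim}$ be the full subcategory of the objects $A$ with $A_n=\Delta^0$ for all $n>\dim A$ (the category of generalized simplices), and let $\mathrm{Set}[\Theta]$ be the category of presheaves of sets on $\Theta$. A face of $A\in\Theta$ is a maximal proper subobject $B\hookrightarrow A$ in $\Theta$, and the boundary $\partial A\subset A$ is the union, inside the presheaf represented by $A$, of the images of all faces of $A$. Call a class of morphisms of a category saturated if it is stable under pushouts (cobase change), transfinite compositions and retracts. **Proposition.** The class of monomorphisms of $\mathrm{Set}[\Theta]$ is the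 saturated class generated by the set of boundary inclusions $\partial A\subset A$, $A\in\Theta$. That is, the class of monomorphisms is saturated, it contains all inclusions $\partial A\subset A$, and it is contained in every saturated class that contains all these inclusions. -/

import Mathlib

open CategoryTheory Opposite

universe w v u

namespace GenSimplex

/-- The (infinite) product of countably many copies of the simplex category `Δ`.
The components usually indexed by `1, 2, 3, …` are numbered `0, 1, 2, …` here. -/
abbrev DeltaPower : Type := ℕ → SimplexCategory

/-- Only finitely many components differ from `Δ⁰ = ⦋0⦌`. -/
def FinitelySupported : ObjectProperty DeltaPower :=
  fun A => {n : ℕ | A n ≠ SimplexCategory.mk 0}.Finite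

/-- The restricted product of countably many copies of `Δ`, as a full subcategory. -/
abbrev RestrictedProduct : Type := FinitelySupported.FullSubcategory

/-- A morphism of `Δ` is constant if it factors through `Δ⁰`. -/
def IsConst {X Y : SimplexCategory} (f : X ⟶ Y) : Prop :=
  ∃ (p : X ⟶ SimplexCategory.mk 0) (q : SimplexCategory.mk 0 ⟶ Y), p ≫ q = f

/-- The `n`-th component of a morphism of the restricted product. -/
abbrev component {A B : RestrictedProduct} (f : A ⟶ B) (n : ℕ) : A.obj n ⟶ B.obj n :=
  f.hom n

/-- The degree of a morphism: the smallest index of a constant component.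
Because components are numbered from `0`, this is the degree for the numbering
from `1`, minus one. The set is never empty, see `isConst_deg`. -/
noncomputable def deg {A B : RestrictedProduct} (f : A ⟶ B) : ℕ :=
  sInf {n : ℕ | IsConst (component f n)}

/-- The dimension of an object: the smallest number `d` such that the component at
place `d` (place `d + 1` for the numbering from `1`) is `Δ⁰`. The set is never empty,
see `obj_dim`. -/
noncomputable def dim (A : RestrictedProduct) : ℕ :=
  sInf {n : ℕ | A.obj n = SimplexCategory.mk 0}

/-- Two parallel morphisms are identified if they have the same degree, and the same
components up to and including the one at the degree. -/
def degRel : HomRel RestrictedProduct :=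
  fun _ _ f g => deg f = deg g ∧ ∀ n ≤ deg f, component f n = component g n

/-! ### The degree and the dimension are attained, and `degRel` is a congruence -/

theorem obj_dim (A : RestrictedProduct) : A.obj (dim A) = SimplexCategory.mk 0 := by
  have h : ∃ n, n ∉ {n : ℕ | A.obj n ≠ SimplexCategory.mk 0} :=
    Set.Infinite.exists_notMem_finite Set.infinite_univ A.property |>.imp fun _ h => h.2
  obtain ⟨n, hn⟩ := h
  have hne : {n : ℕ | A.obj n = SimplexCategory.mk 0}.Nonempty := ⟨n, by simpa using hn⟩
  exact Nat.sInf_mem hne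

theorem isConst_of_eq {X Y : SimplexCategory} (h : X = SimplexCategory.mk 0) (f : X ⟶ Y) :
    IsConst f := by
  subst h
  exact ⟨𝟙 _, f, Category.id_comp f⟩

theorem IsConst.comp_left {X Y Z : SimplexCategory} {g : Y ⟶ Z} (hg : IsConst g)
    (f : X ⟶ Y) : IsConst (f ≫ g) := by
  obtain ⟨p, q, rfl⟩ := hg
  exact ⟨f ≫ p, q, by simp⟩

theorem IsConst.comp_right {X Y Z : SimplexCategory} {f : X ⟶ Y} (hf : IsConst f)
    (g : Y ⟶ Z) : IsConst (f ≫ g) := by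
  obtain ⟨p, q, rfl⟩ := hf
  exact ⟨p, q ≫ g, by simp⟩

theorem isConst_deg {A B : RestrictedProduct} (f : A ⟶ B) :
    IsConst (component f (deg f)) := by
  have hne : {n : ℕ | IsConst (component f n)}.Nonempty :=
    ⟨dim A, isConst_of_eq (obj_dim A) _⟩
  exact Nat.sInf_mem hne

theorem deg_le {A B : RestrictedProduct} {f : A ⟶ B} {n : ℕ}
    (h : IsConst (component f n)) : deg f ≤ n :=
  Nat.sInf_le h

theorem deg_comp_le_left {A B C : RestrictedProduct} (f : A ⟶ B) (g : B ⟶ C) :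
    deg (f ≫ g) ≤ deg f :=
  deg_le ((isConst_deg f).comp_right _)

theorem deg_comp_le_right {A B C : RestrictedProduct} (f : A ⟶ B) (g : B ⟶ C) :
    deg (f ≫ g) ≤ deg g :=
  deg_le ((isConst_deg g).comp_left _)

theorem degRel_of_agree {A B : RestrictedProduct} {f g : A ⟶ B} {d : ℕ} (hf : deg f ≤ d)
    (hg : deg g ≤ d) (h : ∀ n ≤ d, component f n = component g n) : degRel f g := by
  refine ⟨le_antisymm (deg_le ?_) (deg_le ?_), fun n hn => h n (hn.trans hf)⟩
  · rw [h _ hg]; exact isConst_deg g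
  · rw [← h _ hf]; exact isConst_deg f

instance : Congruence degRel where
  equivalence :=
    { refl := fun f => ⟨rfl, fun _ _ => rfl⟩
      symm := fun h => ⟨h.1.symm, fun n hn => (h.2 n (h.1 ▸ hn)).symm⟩
      trans := fun h k => ⟨h.1.trans k.1, fun n hn => (h.2 n hn).trans (k.2 n (h.1 ▸ hn))⟩ }
  comp_left := by
    intro _ _ _ f g g' h
    refine degRel_of_agree (deg_comp_le_right f g) (h.1 ▸ deg_comp_le_right f g') ?_
    intro n hn
    change component f n ≫ component g n = component f n ≫ component g' n
    rw [h.2 n hn]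
  comp_right := by
    intro _ _ _ f f' g h
    refine degRel_of_agree (deg_comp_le_left f g) (h.1 ▸ deg_comp_le_left f' g) ?_
    intro n hn
    change component f n ≫ component g n = component f' n ≫ component g n
    rw [h.2 n hn]

/-! ### The category of generalized simplices -/

/-- The objects of the quotient category all of whose components from the place `dim A`
on are `Δ⁰`, i.e. the objects `(Δ^{a₁}, …, Δ^{a_d}, Δ⁰, Δ⁰, …)` with `a₁, …, a_d ≥ 1`. -/
def IsReduced : ObjectProperty (Quotient degRel) :=
  fun A => ∀ n ≥ dim A.as, A.as.obj n = SimplexCategory.mk 0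

/-- The category of generalized simplices. -/
abbrev Theta : Type := IsReduced.FullSubcategory

/-- Presheaves of sets (in the universe `u`) on the category of generalized simplices. -/
abbrev ThetaSet : Type (u + 1) := Thetaᵒᵖ ⥤ Type u

/-- A face of a generalized simplex: a maximal proper subobject in `Theta`. -/
def IsFace {A : Theta} (F : Subobject A) : Prop := IsCoatom F

/-- The boundary of the representable presheaf on `A`: the union of the images in it of
all the faces of `A`. -/
noncomputable def boundary (A : Theta) : Subfunctor (uliftYoneda.{u}.obj A) :=
  ⨆ (F : Subobject A) (_ : IsFace F), Subfunctor.range (uliftYoneda.{u}.map F.arrow)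

/-- The set of all boundary inclusions `∂A ⊂ A`. -/
def boundaryInclusions : MorphismProperty ThetaSet.{u} :=
  MorphismProperty.ofHoms fun A : Theta => (boundary.{u} A).ι

end GenSimplex

/-- A class of morphisms is saturated if it is stable under cobase change (pushout),
transfinite composition (along well-orders in the universe `w`) and retracts.
In particular it then contains all isomorphisms and is stable under composition. -/
class IsSaturatedClass {C : Type u} [Category.{v} C] (W : MorphismProperty C) : Prop where
  cobaseChange : W.IsStableUnderCobaseChange
  transfiniteComposition : MorphismProperty.IsStableUnderTransfiniteComposition.{w} W
  retracts : W.IsStableUnderRetracts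

namespace GenSimplex

/-! `Theta` behaves like an Eilenberg–Zilber category. Every morphism is a split epimorphism
followed by a monomorphism, proper monomorphisms strictly raise `size`, monic endomorphisms are
identities, and a split epimorphism is determined by its sections (`eq_of_sections`). Hence `∂A`
consists exactly of the maps into `A` that are not split epimorphisms (`mem_boundary_iff`).

A monomorphism is, up to isomorphism, the inclusion of a subpresheaf `S` of `Y`. Well-order the
nondegenerate elements of `Y` outside `S` by size and add them one at a time: adding `y` over `A` is
a pushout along `∂A ⊂ A` (`isPushout_attach`), because `y` restricts injectively along split
epimorphisms. The inclusion of `S` is the transfinite composition of these pushouts. That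
monomorphisms are themselves saturated comes from sets. -/

/-! ### Constant maps and sections in the simplex category. -/

theorem isConst_iff {X Y : SimplexCategory} (f : X ⟶ Y) :
    IsConst f ↔ ∃ y, ∀ x, f.toOrderHom x = y := by
  constructor
  · rintro ⟨p, q, rfl⟩
    refine ⟨q.toOrderHom 0, fun x => ?_⟩
    have : p.toOrderHom x = 0 := Subsingleton.elim (α := Fin 1) _ _
    simp [this]
  · rintro ⟨y, hy⟩
    refine ⟨SimplexCategory.const X _ 0, SimplexCategory.const _ Y y, ?_⟩
    ext x : 3
    simp [hy]

theorem isConst_comp_mono_iff {X Y Z : SimplexCategory} (f : X ⟶ Y) (g : Y ⟶ Z) [Mono g] :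
    IsConst (f ≫ g) ↔ IsConst f := by
  refine ⟨fun h => ?_, fun h => h.comp_right g⟩
  obtain ⟨z, hz⟩ := (isConst_iff _).1 h
  refine (isConst_iff _).2 ⟨f.toOrderHom 0, fun x => ?_⟩
  exact SimplexCategory.mono_iff_injective.1 ‹Mono g› ((hz x).trans (hz 0).symm)

theorem isConst_id_iff (X : SimplexCategory) : IsConst (𝟙 X) ↔ X = SimplexCategory.mk 0 := by
  refine ⟨fun h => ?_, fun h => isConst_of_eq h _⟩
  obtain ⟨p, q, h⟩ := h
  have : Mono p := by
    have : Mono (p ≫ q) := by rw [h]; infer_instance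
    exact mono_of_mono p q
  have := SimplexCategory.len_le_of_mono p
  exact SimplexCategory.ext (by simpa using this)

/-- A split epimorphism of `Δ` is determined by its sections. -/
theorem simplex_eq_of_sections {X Y : SimplexCategory} (p q : X ⟶ Y) (s₀ : Y ⟶ X)
    (hs₀ : s₀ ≫ p = 𝟙 Y) (h : ∀ t : Y ⟶ X, t ≫ p = 𝟙 Y → t ≫ q = 𝟙 Y) : p = q := by
  have hs (y) : p.toOrderHom (s₀.toOrderHom y) = y :=
    congrArg (fun f => f.toOrderHom y) hs₀
  ext x : 3
  -- Move the value of `s₀` at `p x` to `x`. This stays monotone because the fibres of `p` are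
  -- ordered like their images, and testing `q` on this section gives `q x = p x`.
  let t : Y ⟶ X := SimplexCategory.Hom.mk
    { toFun := Function.update s₀.toOrderHom (p.toOrderHom x) x
      monotone' := by
        have key (y : Fin (Y.len + 1)) : (y < p.toOrderHom x → s₀.toOrderHom y ≤ x) ∧
            (p.toOrderHom x < y → x ≤ s₀.toOrderHom y) := by
          constructor <;> intro hy <;> by_contra! hlt
          · have := p.toOrderHom.monotone hlt.le
            rw [hs] at this
            exact absurd hy this.not_gt
          · have := p.toOrderHom.monotone hlt.le
            rw [hs] at this
            exact absurd hy this.not_gt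
        intro a b hab
        simp only [Function.update_apply]
        split_ifs with ha hb hb
        · exact le_rfl
        · exact (key b).2 (lt_of_le_of_ne (ha ▸ hab) (Ne.symm hb))
        · exact (key a).1 (lt_of_le_of_ne (hb ▸ hab) ha)
        · exact s₀.toOrderHom.monotone hab }
  have ht (y) : t.toOrderHom y = Function.update s₀.toOrderHom (p.toOrderHom x) x y := rfl
  have htp : t ≫ p = 𝟙 Y := by
    ext y : 3
    change p.toOrderHom (t.toOrderHom y) = y
    rw [ht, Function.update_apply]
    split_ifs with hy
    · exact hy.symm
    · exact hs y
  have h' : q.toOrderHom (t.toOrderHom (p.toOrderHom x)) = p.toOrderHom x :=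
    congrArg (fun f => f.toOrderHom (p.toOrderHom x)) (h t htp)
  rw [ht, Function.update_self] at h'
  exact h'.symm

/-! ### Morphisms of generalized simplices -/

/-- The component of a generalized simplex at a place. -/
abbrev Theta.comp (A : Theta) (n : ℕ) : SimplexCategory := A.obj.as.obj n

theorem Theta.comp_eq_zero {A : Theta} {n : ℕ} (h : dim A.obj.as ≤ n) :
    A.comp n = SimplexCategory.mk 0 := A.property n h

/-- The morphism of generalized simplices represented by a family of morphisms of `Δ`. -/
def ofComponents {A B : Theta} (f : ∀ n, A.comp n ⟶ B.comp n) : A ⟶ B :=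
  ObjectProperty.homMk ((Quotient.functor degRel).map (X := A.obj.as) (Y := B.obj.as)
    (ObjectProperty.homMk f))

theorem exists_ofComponents {A B : Theta} (f : A ⟶ B) : ∃ g, ofComponents g = f := by
  obtain ⟨g, hg⟩ := (Quotient.functor degRel).map_surjective (X := A.obj.as) (Y := B.obj.as) f.hom
  exact ⟨g.hom, ObjectProperty.hom_ext _ hg⟩

theorem ofComponents_eq_iff {A B : Theta} (f g : ∀ n, A.comp n ⟶ B.comp n) :
    ofComponents f = ofComponents g ↔
      degRel (X := A.obj.as) (Y := B.obj.as) (ObjectProperty.homMk f) (ObjectProperty.homMk g) := by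
  rw [← Quotient.functor_map_eq_iff degRel]
  exact ⟨fun h => congrArg (fun f : A ⟶ B => f.hom) h, fun h => ObjectProperty.hom_ext _ h⟩

theorem ofComponents_comp {A B C : Theta} (f : ∀ n, A.comp n ⟶ B.comp n)
    (g : ∀ n, B.comp n ⟶ C.comp n) :
    ofComponents f ≫ ofComponents g = ofComponents fun n => f n ≫ g n := rfl

theorem ofComponents_id (A : Theta) : ofComponents (fun n => 𝟙 (A.comp n)) = 𝟙 A := rfl

theorem ofComponents_eq_of_agree {A B : Theta} (f g : ∀ n, A.comp n ⟶ B.comp n) (d : ℕ)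
    (hf : IsConst (f d)) (h : ∀ n ≤ d, f n = g n) : ofComponents f = ofComponents g := by
  rw [ofComponents_eq_iff]
  exact degRel_of_agree (d := d) (deg_le hf) (deg_le (by
    change IsConst (g d)
    rwa [← h d le_rfl])) h

theorem isConst_to_zero {X Y : SimplexCategory} (h : Y = SimplexCategory.mk 0) (f : X ⟶ Y) :
    IsConst f := by
  subst h
  exact ⟨f, 𝟙 _, Category.comp_id f⟩

/-- If a family of morphisms represents the identity of `A`, its components up to the
dimension of `A` are identities. -/
theorem eq_id_of_ofComponents_eq_id {A : Theta} {f : ∀ n, A.comp n ⟶ A.comp n}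
    (h : ofComponents f = 𝟙 A) {n : ℕ} (hn : n ≤ dim A.obj.as) : f n = 𝟙 _ := by
  rw [← ofComponents_id, ofComponents_eq_iff] at h
  obtain ⟨h₁, h₂⟩ := (Congruence.equivalence (r := degRel)).symm h
  refine (h₂ n (hn.trans ?_)).symm
  -- The degree of the identity is at least the dimension, since an identity is constant only on
  -- `Δ⁰`.
  exact Nat.sInf_le ((isConst_id_iff _).1 (isConst_deg (A := A.obj.as) (B := A.obj.as)
    (ObjectProperty.homMk fun n => 𝟙 _)))

/-- Composing with monic components leaves constancy, hence the degree, unchanged, so cancellation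
up to the degree suffices. -/
theorem mono_ofComponents {A B : Theta} (f : ∀ n, A.comp n ⟶ B.comp n) [∀ n, Mono (f n)] :
    Mono (ofComponents f) := by
  constructor
  intro C g h hgh
  obtain ⟨g, rfl⟩ := exists_ofComponents g
  obtain ⟨h, rfl⟩ := exists_ofComponents h
  rw [ofComponents_comp, ofComponents_comp, ofComponents_eq_iff] at hgh
  obtain ⟨h₁, h₂⟩ := hgh
  refine ofComponents_eq_of_agree _ _ _ ?_ fun n hn => (cancel_mono (f n)).1 (h₂ n hn)
  exact (isConst_comp_mono_iff (g _) (f _)).1 (isConst_deg (A := C.obj.as) (B := B.obj.as)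
    (ObjectProperty.homMk fun n => g n ≫ f n))

/-! ### Images of morphisms of generalized simplices. -/

/-- Here `k` will be the degree. Truncating the image to `Δ⁰` from `k` on makes it reduced of
dimension exactly `k`; the congruence ignores the components beyond. -/
theorem exists_image_component {A B : Theta} (f : ∀ n, A.comp n ⟶ B.comp n) (k n : ℕ)
    (hk : IsConst (f k)) (hn : n < k → ¬ IsConst (f n)) :
    ∃ (Z : SimplexCategory) (e : A.comp n ⟶ Z) (m : Z ⟶ B.comp n) (s : Z ⟶ A.comp n),
      s ≫ e = 𝟙 Z ∧ Mono m ∧ (n ≤ k → e ≫ m = f n) ∧ (n < k → Z ≠ SimplexCategory.mk 0) ∧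
        (k ≤ n → Z = SimplexCategory.mk 0) := by
  have hmono {Y : SimplexCategory} (m : SimplexCategory.mk 0 ⟶ Y) : Mono m :=
    SimplexCategory.mono_iff_injective.2 fun x y _ => Subsingleton.elim (α := Fin 1) x y
  have hid {X : SimplexCategory} (e : X ⟶ SimplexCategory.mk 0) (s) : s ≫ e = 𝟙 _ := by
    ext x : 3
    exact Subsingleton.elim (α := Fin 1) _ _
  obtain h | rfl | h := lt_trichotomy n k
  · have : Epi (Limits.factorThruImage (f n)) := inferInstance
    have := isSplitEpi_of_epi (Limits.factorThruImage (f n))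
    refine ⟨Limits.image (f n), Limits.factorThruImage (f n), Limits.image.ι (f n),
      section_ (Limits.factorThruImage (f n)), by simp, inferInstance, by simp, fun _ hZ => ?_,
      by omega⟩
    apply hn h
    rw [← Limits.image.fac (f n)]
    exact (isConst_to_zero hZ _).comp_right _
  · obtain ⟨p, q, hpq⟩ := hk
    exact ⟨_, p, q, SimplexCategory.const _ _ 0, hid _ _, hmono _, fun _ => hpq,
      fun h => (lt_irrefl _ h).elim, fun _ => rfl⟩
  · exact ⟨SimplexCategory.mk 0, SimplexCategory.const _ _ 0, SimplexCategory.const _ _ 0,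
      SimplexCategory.const _ _ 0, hid _ _, hmono _, by omega, by omega, fun _ => rfl⟩

/-- Every morphism of generalized simplices is a split epimorphism followed by a monomorphism. -/
theorem exists_components_factorisation {A B : Theta} (f : ∀ n, A.comp n ⟶ B.comp n) :
    ∃ (C : Theta) (e : ∀ n, A.comp n ⟶ C.comp n) (m : ∀ n, C.comp n ⟶ B.comp n)
      (s : ∀ n, C.comp n ⟶ A.comp n), (∀ n, s n ≫ e n = 𝟙 _) ∧ (∀ n, Mono (m n)) ∧
      (∀ n ≤ dim C.obj.as, e n ≫ m n = f n) ∧ IsConst (f (dim C.obj.as)) := by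
  let f' : A.obj.as ⟶ B.obj.as := ObjectProperty.homMk f
  obtain ⟨k, hk, hmin⟩ : ∃ k, IsConst (f k) ∧ ∀ n < k, ¬ IsConst (f n) :=
    ⟨deg f', isConst_deg f', fun n hn h => (deg_le (f := f') h).not_gt hn⟩
  choose Z e m s hse hm hem hne heq using fun n => exists_image_component f k n hk (hmin n)
  have hfin : FinitelySupported Z :=
    (Set.finite_Iio k).subset fun n hn => by
      by_contra h
      exact hn (heq n (by simpa using h))
  have hdim : dim ⟨Z, hfin⟩ = k := by
    refine le_antisymm (Nat.sInf_le (heq k le_rfl)) (le_of_not_gt fun h => ?_)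
    exact hne _ h (obj_dim ⟨Z, hfin⟩)
  exact ⟨⟨⟨⟨Z, hfin⟩⟩, fun n hn => heq n (hdim ▸ hn)⟩, e, m, s, hse, hm,
    fun n hn => hem n (hn.trans hdim.le), by
      change IsConst (f (dim ⟨Z, hfin⟩))
      rwa [hdim]⟩

theorem exists_isSplitEpi_mono_factorisation {A B : Theta} (f : A ⟶ B) :
    ∃ (C : Theta) (e : A ⟶ C) (m : C ⟶ B), IsSplitEpi e ∧ Mono m ∧ e ≫ m = f := by
  obtain ⟨f, rfl⟩ := exists_ofComponents f
  obtain ⟨C, e, m, s, hse, hm, hem, hc⟩ := exists_components_factorisation f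
  refine ⟨C, ofComponents e, ofComponents m,
    ⟨⟨⟨ofComponents s, ?_⟩⟩⟩, mono_ofComponents m, ?_⟩
  · simp only [ofComponents_comp, hse, ofComponents_id]
  · refine (ofComponents_eq_of_agree _ _ _ hc fun n hn => (hem n hn).symm).symm

/-- In the image factorisation of a monomorphism, the split epimorphism `e` is invertible, so its
components in the relevant range are monic. -/
theorem mono_component {A B : Theta} (f : ∀ n, A.comp n ⟶ B.comp n) [Mono (ofComponents f)]
    {n : ℕ} (hn : n ≤ dim A.obj.as) : Mono (f n) := by
  obtain ⟨C, e, m, s, hse, hm, hem, hc⟩ := exists_components_factorisation f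
  have hf : ofComponents e ≫ ofComponents m = ofComponents f :=
    (ofComponents_eq_of_agree _ _ _ hc fun n hn => (hem n hn).symm).symm
  have hs : ofComponents s ≫ ofComponents e = 𝟙 C := by
    simp only [ofComponents_comp, hse, ofComponents_id]
  have hid : ofComponents (fun n => e n ≫ s n) = 𝟙 A := by
    rw [← ofComponents_comp, ← cancel_mono (ofComponents f), ← hf]
    simp only [Category.assoc, Category.id_comp]
    rw [← Category.assoc (ofComponents s), hs, Category.id_comp]
  -- At the place `dim C`, the identity of the component of `A` would factor through `Δ⁰`.
  have hdim : dim A.obj.as ≤ dim C.obj.as := by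
    refine Nat.sInf_le ((isConst_id_iff _).1 ?_)
    by_cases h : dim C.obj.as ≤ dim A.obj.as
    · rw [← eq_id_of_ofComponents_eq_id hid h]
      exact (isConst_to_zero (Theta.comp_eq_zero le_rfl) _).comp_right _
    · exact isConst_of_eq (Theta.comp_eq_zero (by omega)) _
  have h₁ : Mono (e n ≫ s n) := by
    rw [eq_id_of_ofComponents_eq_id hid hn]; infer_instance
  have := mono_of_mono (e n) (s n)
  rw [← hem n (hn.trans hdim)]
  exact mono_comp _ _

/-! ### Rigidity of monomorphisms, and the size. -/

theorem eq_id_of_mono {A : Theta} (f : A ⟶ A) [Mono f] : f = 𝟙 A := by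
  obtain ⟨f, rfl⟩ := exists_ofComponents f
  rw [← ofComponents_id]
  refine ofComponents_eq_of_agree _ _ (dim A.obj.as)
    (isConst_of_eq (Theta.comp_eq_zero le_rfl) _) fun n hn => ?_
  have := mono_component f hn
  exact SimplexCategory.eq_id_of_mono _

theorem len_le_of_mono {A B : Theta} (f : A ⟶ B) [Mono f] (n : ℕ) :
    (A.comp n).len ≤ (B.comp n).len := by
  obtain ⟨f, rfl⟩ := exists_ofComponents f
  by_cases hn : n ≤ dim A.obj.as
  · have := mono_component f hn
    exact SimplexCategory.len_le_of_mono (f n)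
  · rw [Theta.comp_eq_zero (A := A) (by omega)]
    exact Nat.zero_le _

theorem Theta.ext_len {A B : Theta} (h : ∀ n, (A.comp n).len = (B.comp n).len) : A = B := by
  obtain ⟨⟨⟨A, _⟩⟩, _⟩ := A
  obtain ⟨⟨⟨B, _⟩⟩, _⟩ := B
  obtain rfl : A = B := funext fun n => SimplexCategory.ext (h n)
  rfl

/-- The total number of directions of a generalized simplex. -/
noncomputable def size (A : Theta) : ℕ := ∑ᶠ n, (A.comp n).len

theorem finite_support_len (A : Theta) : (Function.support fun n => (A.comp n).len).Finite :=
  A.obj.as.property.subset fun n hn h => hn (by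
    change (A.obj.as.obj n).len = 0
    rw [h])

theorem size_le_of_mono {A B : Theta} (f : A ⟶ B) [Mono f] : size A ≤ size B :=
  finsum_le_finsum' (finite_support_len A) (finite_support_len B) (len_le_of_mono f)

theorem eq_of_mono_of_size_le {A B : Theta} (f : A ⟶ B) [Mono f] (h : size B ≤ size A) :
    A = B := by
  let s := ((finite_support_len A).union (finite_support_len B)).toFinset
  have hA : size A = ∑ n ∈ s, (A.comp n).len :=
    finsum_eq_sum_of_support_subset _ (by simp [s])
  have hB : size B = ∑ n ∈ s, (B.comp n).len :=
    finsum_eq_sum_of_support_subset _ (by simp [s])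
  have hs := (Finset.sum_eq_sum_iff_of_le (s := s) fun n _ => len_le_of_mono f n).1
    (by rw [← hA, ← hB]; exact (size_le_of_mono f).antisymm h)
  refine Theta.ext_len fun n => ?_
  by_cases hn : n ∈ s
  · exact hs n hn
  · simp only [s, Set.Finite.mem_toFinset, Set.mem_union, Function.mem_support, not_or,
      not_not] at hn
    rw [hn.1, hn.2]

/-- A split epimorphism of generalized simplices is determined by its sections. -/
theorem eq_of_sections {A B : Theta} (p q : A ⟶ B) [IsSplitEpi p]
    (h : ∀ s : B ⟶ A, s ≫ p = 𝟙 B → s ≫ q = 𝟙 B) : p = q := by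
  obtain ⟨s, hs⟩ := exists_ofComponents (section_ p)
  obtain ⟨p, rfl⟩ := exists_ofComponents p
  obtain ⟨q, rfl⟩ := exists_ofComponents q
  have hsp := IsSplitEpi.id (ofComponents p)
  rw [← hs, ofComponents_comp] at hsp
  refine ofComponents_eq_of_agree _ _ (dim B.obj.as)
    (isConst_to_zero (Theta.comp_eq_zero le_rfl) _) fun n hn => ?_
  refine simplex_eq_of_sections _ _ (s n) (eq_id_of_ofComponents_eq_id hsp hn) fun t ht => ?_
  -- Components are independent, so replacing the one at `n` by another section of `p n` again gives
  -- a section.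
  have := h (ofComponents (Function.update s n t)) (by
    rw [ofComponents_comp, ← ofComponents_id]
    refine ofComponents_eq_of_agree _ _ (dim B.obj.as)
      (isConst_of_eq (Theta.comp_eq_zero le_rfl) _) fun i hi => ?_
    obtain rfl | hin := eq_or_ne i n
    · rwa [Function.update_self]
    · rw [Function.update_of_ne hin]
      exact eq_id_of_ofComponents_eq_id hsp hi)
  rw [ofComponents_comp] at this
  simpa using eq_id_of_ofComponents_eq_id this hn

/-! ### The boundary -/

theorem isIso_of_mono_of_size_le {A B : Theta} (f : A ⟶ B) [Mono f] (h : size B ≤ size A) :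
    IsIso f := by
  obtain rfl := eq_of_mono_of_size_le f h
  rw [eq_id_of_mono f]
  infer_instance

/-- Size strictly increases along proper inclusions and is bounded by `size A`, so ascending chains
of subobjects stop. -/
theorem exists_face_ge {A : Theta} (F : Subobject A) (hF : F ≠ ⊤) :
    ∃ G : Subobject A, IsFace G ∧ F ≤ G := by
  induction hn : size A - size (F : Theta) using Nat.strong_induction_on generalizing F with
  | _ n ih =>
    by_cases hc : IsFace F
    · exact ⟨F, hc, le_rfl⟩
    obtain ⟨G, hFG, hG⟩ : ∃ G, F < G ∧ G ≠ ⊤ := by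
      by_contra! h
      exact hc ⟨hF, h⟩
    have hlt : size (F : Theta) < size (G : Theta) := by
      by_contra! hle
      have := isIso_of_mono_of_size_le (Subobject.ofLE F G hFG.le) hle
      refine hFG.not_ge (Subobject.le_of_comm (inv (Subobject.ofLE F G hFG.le)) ?_)
      rw [IsIso.inv_comp_eq, Subobject.ofLE_arrow]
    have hle := size_le_of_mono G.arrow
    obtain ⟨H, hH, hGH⟩ := ih (size A - size (G : Theta)) (by omega) G hG rfl
    exact ⟨H, hH, hFG.le.trans hGH⟩

/-- A split epimorphism through a face would split its inclusion and make it all of `A`. Otherwise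
the image is a proper subobject, hence lies in a face. -/
theorem mem_boundary_iff {A B : Theta} (f : B ⟶ A) :
    ULift.up f ∈ (boundary.{u} A).obj (op B) ↔ ¬ IsSplitEpi f := by
  simp only [boundary, Subfunctor.iSup_obj, Set.mem_iUnion, Subfunctor.range_obj, Set.mem_range]
  constructor
  · rintro ⟨F, hF, ⟨g⟩, hg⟩ hf
    obtain rfl : g ≫ F.arrow = f := congrArg ULift.down hg
    have : IsSplitEpi F.arrow :=
      ⟨⟨⟨section_ (g ≫ F.arrow) ≫ g, by rw [Category.assoc, IsSplitEpi.id]⟩⟩⟩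
    exact hF.1 ((Subobject.isIso_arrow_iff_eq_top F).1 (isIso_of_mono_of_isSplitEpi F.arrow))
  · intro hf
    obtain ⟨C, e, m, he, hm, rfl⟩ := exists_isSplitEpi_mono_factorisation f
    obtain ⟨F, hF, hle⟩ := exists_face_ge (Subobject.mk m) fun h => by
      have := (Subobject.isIso_iff_mk_eq_top m).2 h
      exact hf inferInstance
    refine ⟨F, hF, ⟨e ≫ Subobject.ofMkLE m F hle⟩, ?_⟩
    have h : (e ≫ Subobject.ofMkLE m F hle) ≫ F.arrow = e ≫ m := by
      rw [Category.assoc, Subobject.ofMkLE_arrow]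
    exact congrArg ULift.up h

/-! ### Nondegenerate elements -/

/-- An element of a presheaf is nondegenerate if it is the restriction of another element
along monomorphisms only. -/
def IsNondegenerate (Y : ThetaSet.{u}) {A : Theta} (y : Y.obj (op A)) : Prop :=
  ∀ ⦃C : Theta⦄ (g : A ⟶ C) (z : Y.obj (op C)), Y.map g.op z = y → Mono g

theorem exists_nondegenerate (Y : ThetaSet.{u}) {A : Theta} (y : Y.obj (op A)) :
    ∃ (D : Theta) (e : A ⟶ D) (z : Y.obj (op D)),
      IsSplitEpi e ∧ IsNondegenerate Y z ∧ Y.map e.op z = y := by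
  induction hn : size A using Nat.strong_induction_on generalizing A with
  | _ n ih =>
    by_cases hy : IsNondegenerate Y y
    · exact ⟨A, 𝟙 A, y, inferInstance, hy, by simp⟩
    simp only [IsNondegenerate, not_forall] at hy
    obtain ⟨C, g, z, rfl, hg⟩ := hy
    obtain ⟨D, e, m, he, hm, rfl⟩ := exists_isSplitEpi_mono_factorisation g
    -- If the size did not drop, the section of `e` would be invertible, hence so would `e`, and `g`
    -- would be monic.
    have hlt : size D < n := by
      by_contra! h
      have := isIso_of_mono_of_size_le (section_ e) (hn.trans_le h)
      have : IsIso e := by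
        have : IsIso (section_ e ≫ e) := by rw [IsSplitEpi.id]; infer_instance
        exact IsIso.of_isIso_comp_left (section_ e) e
      exact hg inferInstance
    obtain ⟨D', e', z', he', hz', h⟩ := ih _ hlt (Y.map m.op z) rfl
    exact ⟨D', e ≫ e', z', inferInstance, hz', by simp [h]⟩

theorem IsNondegenerate.sigma_eq {Y : ThetaSet.{u}} {A C : Theta} {y : Y.obj (op A)}
    (hy : IsNondegenerate Y y) {z : Y.obj (op C)} (g : A ⟶ C) (h : Y.map g.op z = y)
    (hC : size C ≤ size A) :
    (⟨A, y⟩ : Σ A : Theta, Y.obj (op A)) = ⟨C, z⟩ := by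
  have := hy g z h
  obtain rfl := eq_of_mono_of_size_le g hC
  rw [eq_id_of_mono g] at h
  simp only [op_id, Functor.map_id_apply] at h
  rw [h]

/-- If `s` is a section of `p`, then `y` is its own restriction along `s ≫ q`, which is therefore a
monic endomorphism, that is, the identity. So `s` is a section of `q` too. -/
theorem IsNondegenerate.map_injective {Y : ThetaSet.{u}} {A B : Theta} {y : Y.obj (op A)}
    (hy : IsNondegenerate Y y) (p q : B ⟶ A) [IsSplitEpi p]
    (h : Y.map p.op y = Y.map q.op y) : p = q := by
  refine eq_of_sections p q fun s hs => ?_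
  have : Mono (s ≫ q) := hy _ y (by
    rw [op_comp, Functor.map_comp_apply, ← h, ← Functor.map_comp_apply, ← op_comp,
      hs]
    simp)
  exact eq_id_of_mono _

/-! ### Attaching one cell -/

/-- Restricting `y` along a split epimorphism loses nothing, as a section recovers `y`. Along any
other map the restriction factors through a smaller object, where `S` is everything. -/
theorem preimage_eq_boundary {Y : ThetaSet.{u}} (S : Subfunctor Y) {A : Theta}
    (y : Y.obj (op A)) (hyS : y ∉ S.obj (op A))
    (hS : ∀ (C : Theta) (z : Y.obj (op C)), size C < size A → z ∈ S.obj (op C)) :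
    S.preimage (uliftYonedaEquiv.{u}.symm y) = boundary.{u} A := by
  ext ⟨B⟩ ⟨f⟩
  rw [mem_boundary_iff]
  change Y.map f.op y ∈ S.obj (op B) ↔ _
  constructor
  · intro hf hs
    apply hyS
    have := S.map (section_ f).op hf
    rw [Set.mem_preimage, ← Functor.map_comp_apply, ← op_comp, IsSplitEpi.id] at this
    simpa using this
  · intro hf
    obtain ⟨C, e, m, he, hm, rfl⟩ := exists_isSplitEpi_mono_factorisation f
    rw [op_comp, Functor.map_comp_apply]
    refine S.map e.op (hS C _ ?_)
    by_contra! h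
    have := isIso_of_mono_of_size_le m h
    exact hf inferInstance

open Limits in
theorem isPushout_attach {Y : ThetaSet.{u}} (S T : Subfunctor Y) (hST : S ≤ T) {A : Theta}
    (y : Y.obj (op A)) (hy : IsNondegenerate Y y) (hyS : y ∉ S.obj (op A))
    (hS : ∀ (C : Theta) (z : Y.obj (op C)), size C < size A → z ∈ S.obj (op C))
    (hT : T = S ⊔ Subfunctor.ofSection y) :
    ∃ (t : (boundary.{u} A).toFunctor ⟶ S.toFunctor)
      (b : uliftYoneda.{u}.obj A ⟶ T.toFunctor),
      IsPushout t (boundary.{u} A).ι (Subfunctor.homOfLe hST) b := by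
  have hpre := preimage_eq_boundary S y hyS hS
  have hyT : Subfunctor.range (uliftYonedaEquiv.{u}.symm y) ≤ T := by
    rw [← Subfunctor.ofSection_eq_range', hT]
    exact le_sup_right
  have hSb : Subfunctor.range ((boundary.{u} A).ι ≫ uliftYonedaEquiv.{u}.symm y) ≤ S := by
    rw [Subfunctor.range_comp, Subfunctor.range_ι, Subfunctor.image_le_iff, hpre]
  have hw : Subfunctor.lift _ hSb ≫ Subfunctor.homOfLe hST =
      (boundary.{u} A).ι ≫ Subfunctor.lift _ hyT := by
    rw [← cancel_mono T.ι]
    simp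
  refine ⟨Subfunctor.lift _ hSb, Subfunctor.lift _ hyT, ⟨hw⟩,
    ⟨evaluationJointlyReflectsColimits _ fun ⟨B⟩ =>
      (isColimitMapCoconePushoutCoconeEquiv _ _).2 (IsPushout.isColimit ?_)⟩⟩
  have : Mono ((Subfunctor.homOfLe hST).app (op B)) := inferInstance
  -- In sets it suffices that the square is a pullback, that `S` and the new cell cover `T`, and
  -- that the cell map is injective off the boundary.
  refine Types.isPushout_of_isPullback_of_mono' ?_ ?_ ?_
  · refine (Types.isPullback_iff _ _ _ _).2 ⟨NatTrans.congr_app hw _,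
      fun x₁ x₂ h => Subtype.ext h.2, fun x₂ x₃ h => ?_⟩
    have h' : x₂.1 = (uliftYonedaEquiv.{u}.symm y).app _ x₃ := congrArg Subtype.val h
    refine ⟨⟨x₃, ?_⟩, Subtype.ext h'.symm, rfl⟩
    rw [← hpre]
    change (uliftYonedaEquiv.{u}.symm y).app _ x₃ ∈ S.obj (op B)
    rw [← h']
    exact x₂.2
  · refine Set.eq_univ_of_forall fun x => ?_
    have hx : x.1 ∈ (S ⊔ Subfunctor.ofSection y).obj (op B) := hT ▸ x.2
    obtain hx | ⟨f, hf⟩ := hx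
    · exact Or.inl ⟨⟨x.1, hx⟩, rfl⟩
    · exact Or.inr ⟨⟨f.unop⟩, Subtype.ext hf⟩
  · rintro ⟨f⟩ ⟨g⟩ hf hg h
    have hf' : IsSplitEpi f := by
      by_contra hf'
      exact hf ⟨⟨_, (mem_boundary_iff f).2 hf'⟩, rfl⟩
    exact congrArg ULift.up (hy.map_injective f g (congrArg Subtype.val h))

/-! ### Transfinite compositions of subfunctors -/

section

open Limits

variable {C : Type v} [Category.{w} C] {Y : C ⥤ Type u}

/-- The functor sending a subfunctor to its underlying functor. -/
@[simps]
def subfunctorToFunctor : Subfunctor Y ⥤ C ⥤ Type u where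
  obj S := S.toFunctor
  map h := Subfunctor.homOfLe (leOfHom h)

theorem nonempty_isColimit_of_le_iSup {J : Type u} [LinearOrder J] [Nonempty J]
    (F : J ⥤ Subfunctor Y) (c : Cocone F) (hT : c.pt ≤ ⨆ j, F.obj j) :
    Nonempty (IsColimit (subfunctorToFunctor.mapCocone c)) := by
  refine ⟨evaluationJointlyReflectsColimits _ fun X => ?_⟩
  refine Types.FilteredColimit.isColimitOf' _ _ ?_ ?_
  · rintro ⟨x, hx⟩
    have hx' := hT _ hx
    simp only [Subfunctor.iSup_obj, Set.mem_iUnion] at hx'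
    obtain ⟨j, hj⟩ := hx'
    exact ⟨j, ⟨x, hj⟩, rfl⟩
  · rintro i ⟨x, hx⟩ ⟨y, hy⟩ h
    obtain rfl : x = y := congrArg (fun z : c.pt.toFunctor.obj X => z.1) h
    exact ⟨i, 𝟙 i, rfl⟩

/-- A transfinite chain of subfunctors all of whose steps are in `W` has its
composition in `W`. -/
theorem transfiniteChain_mem (W : MorphismProperty (C ⥤ Type u))
    [W.RespectsIso] [MorphismProperty.IsStableUnderTransfiniteComposition.{u} W]
    {J : Type u} [LinearOrder J] [SuccOrder J] [OrderBot J] [WellFoundedLT J]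
    (G : J → Subfunctor Y) (hG : Monotone G)
    (hlim : ∀ j, Order.IsSuccLimit j → G j ≤ ⨆ i : Set.Iio j, G i)
    (htop : ⨆ j, G j = ⊤)
    (hsucc : ∀ j, ¬ IsMax j → W (Subfunctor.homOfLe (hG (Order.le_succ j)))) :
    W (G ⊥).ι := by
  let c : Cocone hG.functor :=
    { pt := ⊤
      ι := { app j := homOfLE le_top } }
  let t : W.TransfiniteCompositionOfShape J (subfunctorToFunctor.map (c.ι.app ⊥)) :=
    { F := hG.functor ⋙ subfunctorToFunctor
      isoBot := Iso.refl _
      isWellOrderContinuous := ⟨fun j hj => by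
        have : Nonempty (Set.Iio j) := ⟨⟨⊥, hj.bot_lt⟩⟩
        exact nonempty_isColimit_of_le_iSup (J := Set.Iio j)
          ((Set.principalSegIio j).monotone.functor ⋙ hG.functor)
          ((Set.principalSegIio j).cocone hG.functor) (hlim j hj)⟩
      incl := (subfunctorToFunctor.mapCocone c).ι
      isColimit := (nonempty_isColimit_of_le_iSup _ c htop.ge).some
      fac := Category.id_comp _
      map_mem := hsucc }
  refine (W.arrow_mk_iso_iff ?_).1 (W.transfiniteCompositionsOfShape_le J _ t.mem)
  let e : (⊤ : Subfunctor Y).toFunctor ≅ Y := asIso (Subfunctor.ι ⊤)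
  exact Arrow.isoMk (Iso.refl _) e (by ext; rfl)

end

/-! ### The filtration of a presheaf relative to a subpresheaf -/

/-- The nondegenerate elements of a presheaf that are not in a given subpresheaf. -/
def Cell {Y : ThetaSet.{u}} (S : Subfunctor Y) : Type u :=
  {p : Σ A : Theta, Y.obj (op A) // IsNondegenerate Y p.2 ∧ p.2 ∉ S.obj (op p.1)}

theorem exists_cell_order {Y : ThetaSet.{u}} (S : Subfunctor Y) :
    ∃ (_ : LinearOrder (Cell S)), WellFoundedLT (Cell S) ∧
      ∀ a b : Cell S, a ≤ b → size a.1.1 ≤ size b.1.1 := by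
  classical
  let o : LinearOrder (Cell S) := linearOrderOfSTO WellOrderingRel
  have : WellFoundedLT (Cell S) := ⟨(WellOrderingRel.isWellOrder (α := Cell S)).wf⟩
  -- Size decides first; an arbitrary well-order breaks ties.
  let φ : Cell S → ℕ ×ₗ Cell S := fun a => toLex (size a.1.1, a)
  have hφ : Function.Injective φ := fun a b h => congrArg (fun p => (ofLex p).2) h
  refine ⟨LinearOrder.lift' φ hφ, ⟨InvImage.wf φ wellFounded_lt⟩, fun a b h => ?_⟩
  have h : φ a ≤ φ b := h
  rw [Prod.Lex.le_iff] at h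
  exact h.elim le_of_lt fun h => h.1.le

/-- The subpresheaf generated by `S` and by the cells that come before a given place. -/
def filtration {Y : ThetaSet.{u}} (S : Subfunctor Y) [LinearOrder (Cell S)]
    (j : WithTop (Cell S)) : Subfunctor Y :=
  S ⊔ ⨆ e : {e : Cell S // (e : WithTop (Cell S)) < j}, Subfunctor.ofSection e.1.1.2

section

variable {Y : ThetaSet.{u}} (S : Subfunctor Y) [LinearOrder (Cell S)]

theorem mem_filtration_iff (j : WithTop (Cell S)) {A : Theta} (z : Y.obj (op A)) :
    z ∈ (filtration S j).obj (op A) ↔ z ∈ S.obj (op A) ∨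
      ∃ e : Cell S, (e : WithTop (Cell S)) < j ∧ ∃ f : A ⟶ e.1.1, Y.map f.op e.1.2 = z := by
  simp only [filtration, Subfunctor.max_obj, Subfunctor.iSup_obj, Set.mem_union, Set.mem_iUnion,
    Subtype.exists, exists_prop]
  refine or_congr Iff.rfl (exists_congr fun e => and_congr Iff.rfl ?_)
  exact ⟨fun ⟨f, hf⟩ => ⟨f.unop, hf⟩, fun ⟨f, hf⟩ => ⟨f.op, hf⟩⟩

theorem filtration_monotone : Monotone (filtration S) := by
  rintro i j hij ⟨A⟩ z hz
  rw [mem_filtration_iff] at hz ⊢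
  exact hz.imp_right fun ⟨e, he, h⟩ => ⟨e, he.trans_le hij, h⟩

/-- The element `z` is a restriction of a nondegenerate one over an object no larger than `A`, which
lies in `S` or is a cell. -/
theorem mem_filtration_of_forall_lt (j : WithTop (Cell S)) {A : Theta} (z : Y.obj (op A))
    (h : ∀ e : Cell S, size e.1.1 ≤ size A → (e : WithTop (Cell S)) < j) :
    z ∈ (filtration S j).obj (op A) := by
  obtain ⟨D, e, w, he, hw, rfl⟩ := exists_nondegenerate Y z
  refine (filtration S j).map e.op ((mem_filtration_iff S j w).2 ?_)
  by_cases hwS : w ∈ S.obj (op D)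
  · exact Or.inl hwS
  · exact Or.inr ⟨⟨⟨D, w⟩, hw, hwS⟩, h _ (size_le_of_mono (section_ e)), 𝟙 D, by simp⟩

theorem filtration_top : filtration S ⊤ = ⊤ := by
  rw [eq_top_iff]
  rintro ⟨A⟩ z -
  exact mem_filtration_of_forall_lt S _ z fun e _ => WithTop.coe_lt_top e

/-- An earlier cell restricting to `e` has no larger size, so nondegeneracy of `e` would force the
two to coincide. -/
theorem cell_notMem_filtration (hsize : ∀ a b : Cell S, a ≤ b → size a.1.1 ≤ size b.1.1)
    (e : Cell S) : e.1.2 ∉ (filtration S e).obj (op e.1.1) := by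
  rw [mem_filtration_iff]
  rintro (h | ⟨d, hd, f, hf⟩)
  · exact e.2.2 h
  · have hde := WithTop.coe_lt_coe.1 hd
    exact hde.ne' (Subtype.ext (e.2.1.sigma_eq f hf (hsize _ _ hde.le)))

variable [SuccOrder (WithTop (Cell S))]

theorem filtration_succ (e : Cell S) :
    filtration S (Order.succ (e : WithTop (Cell S))) =
      filtration S e ⊔ Subfunctor.ofSection e.1.2 := by
  have hlt : (e : WithTop (Cell S)) < Order.succ (e : WithTop (Cell S)) :=
    Order.lt_succ_of_not_isMax (WithTop.coe_lt_top e).not_isMax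
  refine le_antisymm ?_ (sup_le (filtration_monotone S hlt.le) ?_)
  · rintro ⟨A⟩ z hz
    obtain hz | ⟨d, hd, f, hf⟩ := (mem_filtration_iff S _ z).1 hz
    · exact Or.inl ((mem_filtration_iff S _ z).2 (Or.inl hz))
    · obtain h | h := (Order.le_of_lt_succ hd).lt_or_eq
      · exact Or.inl ((mem_filtration_iff S _ z).2 (Or.inr ⟨d, h, f, hf⟩))
      · obtain rfl := WithTop.coe_inj.1 h
        exact Or.inr ⟨f.op, hf⟩
  · rw [Subfunctor.ofSection_le_iff]
    exact (mem_filtration_iff S _ _).2 (Or.inr ⟨e, hlt, 𝟙 _, by simp⟩)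

theorem filtration_limit (j : WithTop (Cell S)) (hj : Order.IsSuccLimit j) :
    filtration S j ≤ ⨆ i : Set.Iio j, filtration S i := by
  -- Some earlier stage is needed to receive the elements of `S`.
  obtain ⟨i, hi⟩ := not_isMin_iff.1 hj.not_isMin
  rintro ⟨A⟩ z hz
  simp only [Subfunctor.iSup_obj, Set.mem_iUnion]
  obtain hz | ⟨e, he, f, hf⟩ := (mem_filtration_iff S _ z).1 hz
  · exact ⟨⟨i, hi⟩, (mem_filtration_iff S _ z).2 (Or.inl hz)⟩
  · refine ⟨⟨Order.succ e, hj.succ_lt he⟩, (mem_filtration_iff S _ z).2 (Or.inr ⟨e, ?_, f, hf⟩)⟩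
    exact Order.lt_succ_of_not_isMax he.not_isMax

end

/-! ### Saturated classes and monomorphisms. -/

theorem subfunctor_ι_mem (W : MorphismProperty ThetaSet.{u}) [IsSaturatedClass.{u} W]
    (hW : boundaryInclusions.{u} ≤ W) {Y : ThetaSet.{u}} (S : Subfunctor Y) : W S.ι := by
  have := IsSaturatedClass.cobaseChange.{u} (W := W)
  have := IsSaturatedClass.transfiniteComposition.{u} (W := W)
  obtain ⟨_, _, hsize⟩ := exists_cell_order S
  let _ : SuccOrder (WithTop (Cell S)) := SuccOrder.ofLinearWellFoundedLT _
  let _ : OrderBot (WithTop (Cell S)) := WellFoundedLT.toOrderBot _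
  have hbot : filtration S ⊥ = S := by
    refine le_antisymm ?_ le_sup_left
    rintro ⟨A⟩ z hz
    exact ((mem_filtration_iff S _ z).1 hz).resolve_right fun ⟨e, he, _⟩ => not_lt_bot he
  have := transfiniteChain_mem W (filtration S) (filtration_monotone S) (filtration_limit S)
    (top_unique ((filtration_top S).ge.trans (le_iSup (filtration S) ⊤))) fun j hj => by
      -- The top index is maximal, so every successor step starts at a cell `e`.
      obtain _ | e := j
      · exact (hj isMax_top).elim
      obtain ⟨t, b, h⟩ := isPushout_attach (filtration S e) _
        (filtration_monotone S (Order.le_succ _)) e.1.2 e.2.1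
        (cell_notMem_filtration S hsize e) (fun C z hz => mem_filtration_of_forall_lt S _ z
          fun d hd => WithTop.coe_lt_coe.2 (lt_of_not_ge fun h =>
            ((hsize _ _ h).trans hd).not_gt hz)) (filtration_succ S e)
      exact W.of_isPushout h (hW _ (MorphismProperty.ofHoms.mk _))
  rwa [hbot] at this

instance isSaturatedClass_monomorphisms :
    IsSaturatedClass.{u} (MorphismProperty.monomorphisms ThetaSet.{u}) where
  cobaseChange := by
    rw [← MorphismProperty.functorCategory_monomorphisms]
    infer_instance
  transfiniteComposition := { }
  retracts := inferInstance

end GenSimplex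

theorem mainTheorem8 :
    IsLeast {W : MorphismProperty GenSimplex.ThetaSet.{u} |
        IsSaturatedClass.{u} W ∧ GenSimplex.boundaryInclusions.{u} ≤ W}
      (MorphismProperty.monomorphisms GenSimplex.ThetaSet.{u}) := by
  refine ⟨⟨inferInstance, ?_⟩, ?_⟩
  · rintro _ _ _ ⟨A⟩
    exact MorphismProperty.monomorphisms.infer_property _
  · rintro W ⟨hW, hle⟩ X Y f (hf : Mono f)
    have := IsSaturatedClass.cobaseChange.{u} (W := W)
    -- A monomorphism is isomorphic to the inclusion of its image.
    have e : Arrow.mk f ≅ Arrow.mk (Subfunctor.range f).ι :=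
      Arrow.isoMk (asIso (Subfunctor.toRange f)) (Iso.refl _) (by simp)
    exact (W.arrow_mk_iso_iff e).2 (GenSimplex.subfunctor_ι_mem W hle (Subfunctor.range f))
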